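/- Let $d\ge 0$ and $M\ge 1$ be integers, $\alpha\in(0,1]$, $\beta\ge 0$ and $c_\alpha,c_\beta>0$. There is a constant $C>0$, depending only on $d,M,\alpha,\beta,c_\alpha,c_\beta$, such that the following holds. Let $\mathcal X\subset\mathbb R^d$, let $P$ be a probability distribution on $\mathcal X\times\{1,\dots,M\}$ with $\mathcal X$-marginal $P_X$, and let $p(\cdot|x)$, $x\in\mathcal X$, be a (regular) conditional distribution of the label $Y$ given $X=x$ under $P$. Assume (i) $|p(m|x')-p(m|x)|\le c_\alpha\|x'-x\|_2^\alpha$ for all $x,x'\in\mathcal X$ and all $m\in\{1,\dots,M\}$; (ii) $P_X\big(p(m|X)\le s\big)\le c_\beta s^\beta$ for all $s\in(0,1]$ and all $m\in\{1,\dots,M\}$. Let $0<\gamma<(2M)^{-1/\alpha}$ and $0<t\le\gamma^\alpha$ (so that $t<1/(2M)$). Let $H$ be the reproducing kernel Hilbert space on $\mathbb R^d$ of the Gaussian kernel $k(x,x')=\exp(-\|x-x'\|_2^2/\gamma^2)$ and $$\mathcal F=\{f=(f_m)_{m=1}^M:\ f_m\in H \text{ for } m<M,\ f_M=0\}.$$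 For $f\in\mathcal F$ let $p_f(m|x)=e^{f_m(x)}/\sum_{j=1}^M e^{f_j(x)}$ and define its truncation $p_f^t(\cdot|x)$ by $p_f^t(m|x)=t$ if $p_f(m|x)<t$, and $$p_f^t(m|x)=p_f(m|x)-\big(p_f(m|x)-t\big)\,\frac{\sum_{j:\,p_f(j|x)<t}\big(t-p_f(j|x)\big)}{\sum_{\ell:\,p_f(\ell|x)\ge t}\big(p_f(\ell|x)-t\big)}\quad\text{if } p_f(m|x)\ge t .$$ For a measurable predictor $q$ with values in the probability simplex let $\mathcal R(q)=\int -\log q(y|x)\,dP(x,y)\in[0,\infty]$ (with $-\log 0=\infty$) be its cross-entropy risk, and let $\mathcal R^*$ be the infimum of $\mathcal R(q)$ over all such predictors. Then there exists $f_0\in\mathcal F$ such that $$\mathcal R(p_{f_0}^t)-\mathcal R^*\le C\,\gamma^{\alpha(1+\min\{\beta,1\})}.$$ -/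

import Mathlib

open MeasureTheory ProbabilityTheory
open scoped ENNReal

/-- The Gaussian kernel `k(x, x') = exp (-‖x - x'‖₂² / γ²)` on `ℝ^d`. Mathlib's kernels are
operator valued, so the scalar `k(x, x')` is written as the operator `k(x, x') • id` on `ℝ`. -/
noncomputable def gaussianKernel (d : ℕ) (γ : ℝ) :
    Matrix (EuclideanSpace ℝ (Fin d)) (EuclideanSpace ℝ (Fin d)) (ℝ →L[ℝ] ℝ) :=
  Matrix.of fun x x' => Real.exp (-‖x - x'‖ ^ 2 / γ ^ 2) • ContinuousLinearMap.id ℝ ℝ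

/-- The Gaussian kernel as the characteristic function of a standard Gaussian vector. -/
theorem gaussian_eq_integral_cos (d : ℕ) (γ : ℝ) (x x' : EuclideanSpace ℝ (Fin d)) :
    Real.exp (-‖x - x'‖ ^ 2 / γ ^ 2) =
      ∫ z, Real.cos (inner ℝ z ((√2 / γ) • x) - inner ℝ z ((√2 / γ) • x'))
        ∂(stdGaussian (EuclideanSpace ℝ (Fin d))) := by
  have h := charFun_stdGaussian (E := EuclideanSpace ℝ (Fin d)) ((√2 / γ) • (x - x'))
  have hint : Integrable (fun z : EuclideanSpace ℝ (Fin d) =>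
      Complex.exp ((inner ℝ z ((√2 / γ) • (x - x')) : ℝ) * Complex.I))
      (stdGaussian (EuclideanSpace ℝ (Fin d))) := by
    refine Integrable.of_bound (C := 1) (by fun_prop) (Filter.Eventually.of_forall fun z => ?_)
    rw [Complex.norm_exp_ofReal_mul_I]
  have h2 := congrArg Complex.re h
  rw [charFun_apply] at h2
  have h3 := integral_re hint
  simp only [RCLike.re_eq_complex_re] at h3
  rw [← h3] at h2
  simp only [Complex.exp_ofReal_mul_I_re] at h2
  have h4 : Complex.exp (-(‖(√2 / γ) • (x - x')‖ : ℂ) ^ 2 / 2) =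
      ((Real.exp (-‖x - x'‖ ^ 2 / γ ^ 2) : ℝ) : ℂ) := by
    rw [norm_smul, Complex.ofReal_exp]
    congr 1
    rw [← Complex.ofReal_pow, mul_pow, Real.norm_eq_abs, sq_abs, div_pow,
      Real.sq_sqrt (by norm_num)]
    push_cast
    ring
  rw [h4, Complex.ofReal_re] at h2
  rw [← h2]
  simp only [smul_sub, inner_sub_right]

theorem gaussianKernel_posSemidef (d : ℕ) (γ : ℝ) : (gaussianKernel d γ).PosSemidef := by
  have htfae := (RKHS.posSemidef_tfae (𝕜 := ℝ) (K := gaussianKernel d γ)).out 0 2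
  rw [htfae]
  refine ⟨?_, fun v => ?_⟩
  · ext x y
    have hid : star (ContinuousLinearMap.id ℝ ℝ) = ContinuousLinearMap.id ℝ ℝ :=
      star_one (ℝ →L[ℝ] ℝ)
    simp [gaussianKernel, norm_sub_rev y x, hid]
  · set μ := stdGaussian (EuclideanSpace ℝ (Fin d)) with hμ
    set a : EuclideanSpace ℝ (Fin d) → EuclideanSpace ℝ (Fin d) → ℝ :=
      fun x z => inner ℝ z ((√2 / γ) • x) with ha
    have hac : ∀ x, Measurable (a x) := fun x => by fun_prop
    have hb : ∀ x y, Integrable (fun z => Real.cos (a x z - a y z)) μ := fun x y => by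
      refine Integrable.of_bound (C := 1) ?_ (Filter.Eventually.of_forall fun z => ?_)
      · exact (Real.measurable_cos.comp ((hac x).sub (hac y))).aestronglyMeasurable
      · simpa using Real.abs_cos_le_one _
    have key : (v.sum fun x w => v.sum fun x' w' =>
        inner ℝ (gaussianKernel d γ x' x w) w') =
        ∫ z, ((∑ x ∈ v.support, v x * Real.cos (a x z)) ^ 2 +
          (∑ x ∈ v.support, v x * Real.sin (a x z)) ^ 2) ∂μ := by
      have e1 : ∀ z, ((∑ x ∈ v.support, v x * Real.cos (a x z)) ^ 2 +
          (∑ x ∈ v.support, v x * Real.sin (a x z)) ^ 2) =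
          ∑ x ∈ v.support, ∑ y ∈ v.support, v x * v y * Real.cos (a y z - a x z) := by
        intro z
        rw [sq, sq, Finset.sum_mul_sum, Finset.sum_mul_sum, ← Finset.sum_add_distrib]
        refine Finset.sum_congr rfl fun x _ => ?_
        rw [← Finset.sum_add_distrib]
        refine Finset.sum_congr rfl fun y _ => ?_
        rw [Real.cos_sub]
        ring
      simp only [e1]
      rw [integral_finsetSum _ fun x _ => integrable_finsetSum _ fun y _ =>
        (hb y x).const_mul _]
      simp only [Finsupp.sum]
      refine Finset.sum_congr rfl fun x _ => ?_
      rw [integral_finsetSum _ fun y _ => (hb y x).const_mul _]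
      refine Finset.sum_congr rfl fun y _ => ?_
      rw [integral_const_mul, ← gaussian_eq_integral_cos]
      simp [gaussianKernel]
      ring
    simp only [RCLike.re_to_real]
    rw [key]
    exact integral_nonneg fun z => by positivity

instance gaussianKernel_fact (d : ℕ) (γ : ℝ) : Fact (gaussianKernel d γ).PosSemidef :=
  ⟨gaussianKernel_posSemidef d γ⟩

/-- The reproducing kernel Hilbert space of functions `ℝ^d → ℝ` of the Gaussian kernel with
bandwidth `γ`. -/
abbrev GaussianRKHS (d : ℕ) (γ : ℝ) : Type := RKHS.OfKernel (gaussianKernel d γ)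

/-- The class of score functions: `M`-tuples in the Gaussian RKHS with last component zero. The
classes `1, …, M` are indexed by `Fin M`, so the last class is the index `m` with `m + 1 = M`. -/
def scoreClass (M d : ℕ) (γ : ℝ) : Set (Fin M → GaussianRKHS d γ) :=
  {f | ∀ m : Fin M, (m : ℕ) + 1 = M → f m = 0}

/-- The softmax model `p_f(m|x) = exp (f_m(x)) / ∑_j exp (f_j(x))`. -/
noncomputable def softmaxModel {M d : ℕ} {γ : ℝ} (f : Fin M → GaussianRKHS d γ)
    (x : EuclideanSpace ℝ (Fin d)) (m : Fin M) : ℝ :=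
  Real.exp (f m x) / ∑ j, Real.exp (f j x)

/-- Truncation of a probability vector from below at the level `t`. -/
noncomputable def truncateBelow {M : ℕ} (t : ℝ) (q : Fin M → ℝ) (m : Fin M) : ℝ :=
  if q m < t then t
  else q m - (q m - t) * ((∑ j with q j < t, (t - q j)) / ∑ l with t ≤ q l, (q l - t))

/-- The cross-entropy loss `-log q(y)` in `[0, ∞]` of a probability vector `q`, with
`-log 0 = ∞`. -/
noncomputable def ceLoss {M : ℕ} (y : Fin M) (q : Fin M → ℝ) : ℝ≥0∞ :=
  if q y ≤ 0 then ⊤ else ENNReal.ofReal (-Real.log (q y))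

/-- The cross-entropy risk of a predictor `q` under the law `P` of `(X, Y)`. -/
noncomputable def ceRisk {𝒳 : Type*} [MeasurableSpace 𝒳] {M : ℕ} (P : Measure (𝒳 × Fin M))
    (q : 𝒳 → Fin M → ℝ) : ℝ≥0∞ :=
  ∫⁻ z, ceLoss z.2 (q z.1) ∂P

/-- The minimal cross-entropy risk over all measurable predictors with values in the probability
simplex. -/
noncomputable def minCERisk {𝒳 : Type*} [MeasurableSpace 𝒳] {M : ℕ}
    (P : Measure (𝒳 × Fin M)) : ℝ≥0∞ :=
  ⨅ q ∈ {q : 𝒳 → Fin M → ℝ | Measurable q ∧ ∀ x, q x ∈ stdSimplex ℝ (Fin M)}, ceRisk P q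

/-- The conditional class probability `p(m|x)` given by a kernel `κ` from features to labels. -/
noncomputable def condProb {𝒳 : Type*} [MeasurableSpace 𝒳] {M : ℕ} (κ : Kernel 𝒳 (Fin M))
    (m : Fin M) (x : 𝒳) : ℝ :=
  (κ x).real {m}

/-- Hölder smoothness of the conditional class probabilities. -/
def HolderSmooth {M d : ℕ} {𝒳 : Set (EuclideanSpace ℝ (Fin d))} (κ : Kernel 𝒳 (Fin M))
    (α cα : ℝ) : Prop :=
  ∀ (m : Fin M) (x x' : 𝒳),
    |condProb κ m x' - condProb κ m x| ≤
      cα * ‖(x' : EuclideanSpace ℝ (Fin d)) - (x : EuclideanSpace ℝ (Fin d))‖ ^ α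

/-- Small value bound: `P_X(p(m|X) ≤ s) ≤ cβ s^β` for all `s ∈ (0, 1]` and all classes `m`. -/
def SmallValueBound {𝒳 : Type*} [MeasurableSpace 𝒳] {M : ℕ} (P : Measure (𝒳 × Fin M))
    (κ : Kernel 𝒳 (Fin M)) (β cβ : ℝ) : Prop :=
  ∀ (m : Fin M) (s : ℝ), 0 < s → s ≤ 1 →
    P.fst {x | condProb κ m x ≤ s} ≤ ENNReal.ofReal (cβ * s ^ β)

/-! No norm of the scores enters the bound, so universality of the Gaussian RKHS makes the
approximation error arbitrarily small, and the Hölder condition serves only for continuity. What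
remains is the price of keeping probabilities away from zero.

Floor `p(·|x)` at `2t` and renormalize. The excess cross-entropy is at most the added mass, whose
integral is at most `∑ m, 2t · P_X(p(m|X) ≤ 2t) = O(t^(1+β))`, hence `O(γ^(α(1+β)))`. On a large
compact set RKHS scores reproduce the log-ratios of this floored vector
(`exists_mem_scoreClass_near`); since `2Mt < 1`, the resulting softmax stays above `t` and
truncation does nothing. Off the compact set truncation caps the loss at `-log t`, and the mass
there is as small as desired. Gibbs' inequality bounds the minimal risk below by the conditional
entropy (`lintegral_entropy_le_minCERisk`). -/

/-- A uniformly continuous real function on a subset of a metric space extends continuously. -/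
theorem UniformContinuous.exists_continuousMap_extension {E : Type*} [MetricSpace E] {s : Set E}
    {f : s → ℝ} (hf : UniformContinuous f) : ∃ g : C(E, ℝ), ∀ x : s, g x = f x := by
  -- Uniform continuity extends `f` to the closure, and Tietze extends it from there.
  let e : s → closure s := Set.inclusion subset_closure
  have he : IsUniformInducing e := (isUniformEmbedding_set_inclusion subset_closure).isUniformInducing
  have hd : DenseRange e := denseRange_inclusion_iff subset_closure |>.2 le_rfl
  have hc := (uniformContinuous_uniformly_extend he hd hf).continuous
  obtain ⟨g, hg⟩ := ContinuousMap.exists_restrict_eq isClosed_closure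
    (⟨_, hc⟩ : C(closure s, ℝ))
  refine ⟨g, fun x => ?_⟩
  have := DFunLike.congr_fun hg (e x)
  refine this.trans ?_
  exact (he.isDenseInducing hd).extend_eq hf.continuous x

theorem HolderSmooth.uniformContinuous {M d : ℕ} {𝒳 : Set (EuclideanSpace ℝ (Fin d))}
    {κ : Kernel 𝒳 (Fin M)} {α cα : ℝ} (h : HolderSmooth κ α cα) (hα : 0 < α) (hcα : 0 < cα)
    (m : Fin M) : UniformContinuous (condProb κ m) := by
  rw [Metric.uniformContinuous_iff]
  intro ε hε
  refine ⟨(ε / cα) ^ α⁻¹, by positivity, fun x y hxy => ?_⟩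
  rw [Real.dist_eq]
  refine (h m y x).trans_lt ?_
  have hxy' : ‖(x : EuclideanSpace ℝ (Fin d)) - y‖ < (ε / cα) ^ α⁻¹ := by
    rwa [← dist_eq_norm]
  have h1 := Real.rpow_lt_rpow (norm_nonneg _) hxy' hα
  rw [Real.rpow_inv_rpow (by positivity) hα.ne', lt_div_iff₀ hcα] at h1
  linarith

/-! ### Universality of the Gaussian RKHS -/

theorem kerFun_gaussianKernel_apply (d : ℕ) (γ : ℝ) (y x : EuclideanSpace ℝ (Fin d)) :
    RKHS.kerFun (GaussianRKHS d γ) y (1 : ℝ) x = Real.exp (-‖x - y‖ ^ 2 / γ ^ 2) := by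
  rw [RKHS.kerFun_apply, RKHS.OfKernel.kernel_ofKernel]
  simp [gaussianKernel]

/-- The exponential of a linear form, as a continuous function. -/
noncomputable def expInner {d : ℕ} (a : EuclideanSpace ℝ (Fin d)) :
    C(EuclideanSpace ℝ (Fin d), ℝ) :=
  ⟨fun x => Real.exp (inner ℝ x a), by fun_prop⟩

/-- Expanding the square, `k(x, y)` is `exp(-‖x‖²/γ²) exp(2⟨x, y⟩/γ²)` times a constant in `x`, so
`y = (γ²/2) a` yields `exp ⟨x, a⟩`. These exponentials are closed under products, so the algebra
they generate is their span. -/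
theorem exists_gaussianRKHS_eq_of_mem_adjoin {d : ℕ} {γ : ℝ} (hγ : 0 < γ)
    {g : C(EuclideanSpace ℝ (Fin d), ℝ)}
    (hg : g ∈ Algebra.adjoin ℝ (Set.range (expInner (d := d)))) :
    ∃ h : GaussianRKHS d γ, ∀ x, h x = g x * Real.exp (-‖x‖ ^ 2 / γ ^ 2) := by
  rw [← Subalgebra.mem_toSubmodule, Algebra.adjoin_eq_span] at hg
  induction hg using Submodule.span_induction with
  | mem g hg =>
    obtain ⟨a, rfl⟩ : ∃ a, expInner a = g := by
      induction hg using Submonoid.closure_induction with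
      | mem g hg => exact hg
      | one => exact ⟨0, by ext x; simp [expInner]⟩
      | mul f g _ _ hf hg =>
        obtain ⟨a, rfl⟩ := hf
        obtain ⟨b, rfl⟩ := hg
        exact ⟨a + b, by ext x; simp [expInner, inner_add_right, Real.exp_add]⟩
    set y := (γ ^ 2 / 2) • a with hy
    refine ⟨Real.exp (‖y‖ ^ 2 / γ ^ 2) • RKHS.kerFun (GaussianRKHS d γ) y (1 : ℝ), fun x => ?_⟩
    rw [RKHS.coe_smul, Pi.smul_apply, kerFun_gaussianKernel_apply, smul_eq_mul, ← Real.exp_add]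
    change _ = Real.exp (inner ℝ x a) * _
    rw [← Real.exp_add, norm_sub_sq_real]
    have : inner ℝ x y = γ ^ 2 / 2 * inner ℝ x a := by rw [hy, inner_smul_right]
    rw [this]
    congr 1
    field_simp
    ring
  | zero => exact ⟨0, fun x => by simp⟩
  | add f g _ _ hf hg =>
    obtain ⟨u, hu⟩ := hf
    obtain ⟨v, hv⟩ := hg
    exact ⟨u + v, fun x => by simp [hu, hv, add_mul]⟩
  | smul c f _ hf =>
    obtain ⟨u, hu⟩ := hf
    exact ⟨c • u, fun x => by simp [hu, mul_assoc]⟩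

/-- The Gaussian RKHS is universal. -/
theorem exists_gaussianRKHS_near {d : ℕ} {γ : ℝ} (hγ : 0 < γ)
    (f : C(EuclideanSpace ℝ (Fin d), ℝ)) {K : Set (EuclideanSpace ℝ (Fin d))} (hK : IsCompact K)
    {ε : ℝ} (hε : 0 < ε) :
    ∃ h : GaussianRKHS d γ, Continuous h ∧ ∀ x ∈ K, |h x - f x| ≤ ε := by
  have hsep : (Algebra.adjoin ℝ (Set.range (expInner (d := d)))).SeparatesPoints := by
    intro x y hxy
    refine ⟨expInner (x - y), ⟨_, Algebra.subset_adjoin ⟨_, rfl⟩, rfl⟩, fun h => hxy ?_⟩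
    have h' : inner ℝ x (x - y) = inner ℝ y (x - y) := Real.exp_injective h
    rw [← sub_eq_zero, ← inner_sub_left, inner_self_eq_zero] at h'
    exact sub_eq_zero.1 h'
  -- Stone–Weierstrass is applied to `f` divided by the Gaussian weight; multiplying back by a
  -- weight at most 1 does not increase the error.
  let F : C(EuclideanSpace ℝ (Fin d), ℝ) := ⟨fun x => f x * Real.exp (‖x‖ ^ 2 / γ ^ 2), by fun_prop⟩
  obtain ⟨g, hg, hgF⟩ :=
    ContinuousMap.exists_mem_subalgebra_near_continuous_of_isCompact_of_separatesPoints hsep F hK hε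
  obtain ⟨h, hh⟩ := exists_gaussianRKHS_eq_of_mem_adjoin hγ hg
  refine ⟨h, ?_, fun x hx => ?_⟩
  · rw [show (h : EuclideanSpace ℝ (Fin d) → ℝ) = _ from funext hh]
    fun_prop
  · have h1 : f x = F x * Real.exp (-‖x‖ ^ 2 / γ ^ 2) := by
      change _ = f x * _ * _
      rw [mul_assoc, ← Real.exp_add, neg_div, add_neg_cancel, Real.exp_zero, mul_one]
    have h2 : Real.exp (-‖x‖ ^ 2 / γ ^ 2) ≤ 1 := by
      rw [Real.exp_le_one_iff, neg_div]
      exact neg_nonpos.2 (by positivity)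
    rw [hh, h1, ← sub_mul, abs_mul, Real.abs_exp]
    exact (mul_le_of_le_one_right (abs_nonneg _) h2).trans (hgF x hx).le
-- Softmax and truncation
theorem softmaxModel_mem_stdSimplex {M d : ℕ} [NeZero M] {γ : ℝ} (f : Fin M → GaussianRKHS d γ)
    (x : EuclideanSpace ℝ (Fin d)) : softmaxModel f x ∈ stdSimplex ℝ (Fin M) := by
  have h : 0 < ∑ j, Real.exp (f j x) :=
    Finset.sum_pos (fun _ _ => Real.exp_pos _) Finset.univ_nonempty
  refine ⟨fun m => div_nonneg (Real.exp_pos _).le h.le, ?_⟩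
  simp only [softmaxModel]
  rw [← Finset.sum_div, div_self h.ne']

theorem truncateBelow_eq_self {M : ℕ} {t : ℝ} {q : Fin M → ℝ} (h : ∀ m, t ≤ q m) :
    truncateBelow t q = q := by
  ext m
  have : Finset.univ.filter (fun j => q j < t) = ∅ :=
    Finset.filter_eq_empty_iff.2 fun j _ => not_lt.2 (h j)
  simp [truncateBelow, not_lt.2 (h m), this]

/-- Since `∑ (q j - t) = 1 - M t ≥ 0`, the total deficit below `t` is at most the surplus above it,
so each entry gives up at most its own surplus. -/
theorem le_truncateBelow {M : ℕ} {t : ℝ} {q : Fin M → ℝ} (hq : q ∈ stdSimplex ℝ (Fin M))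
    (ht : M * t ≤ 1) (m : Fin M) : t ≤ truncateBelow t q m := by
  unfold truncateBelow
  split_ifs with h
  · exact le_rfl
  · push Not at h
    have hB : 0 ≤ ∑ l with t ≤ q l, (q l - t) :=
      Finset.sum_nonneg fun l hl => sub_nonneg.2 (Finset.mem_filter.1 hl).2
    have hAB : ∑ j with q j < t, (t - q j) ≤ ∑ l with t ≤ q l, (q l - t) := by
      have h1 : ∑ j, (q j - t) = 1 - M * t := by
        rw [Finset.sum_sub_distrib, hq.2]; simp
      have h2 := Finset.sum_filter_add_sum_filter_not Finset.univ (fun j => q j < t)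
        (fun j => q j - t)
      simp only [not_lt] at h2
      have h3 : ∑ j with q j < t, (t - q j) = -∑ j with q j < t, (q j - t) := by
        rw [← Finset.sum_neg_distrib]; simp
      linarith
    have h1 := mul_le_mul_of_nonneg_left (div_le_one_of_le₀ hAB hB) (sub_nonneg.2 h)
    linarith

/-- Softmax ignores the common shift `c`; numerator and denominator each lose a factor `exp(-ε)`. -/
theorem mul_softmaxModel_ge {M d : ℕ} {γ ε c : ℝ} (f : Fin M → GaussianRKHS d γ)
    (x : EuclideanSpace ℝ (Fin d)) {a : Fin M → ℝ} (ha : ∀ m, 0 < a m)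
    (h : ∀ m, |f m x - (Real.log (a m) - c)| ≤ ε) (m : Fin M) :
    Real.exp (-(2 * ε)) * (a m / ∑ j, a j) ≤ softmaxModel f x m := by
  have : Nonempty (Fin M) := ⟨m⟩
  have hS : 0 < ∑ j, a j := Finset.sum_pos (fun j _ => ha j) Finset.univ_nonempty
  have hT : 0 < ∑ j, Real.exp (f j x) :=
    Finset.sum_pos (fun _ _ => Real.exp_pos _) Finset.univ_nonempty
  have h1 : Real.exp (-ε - c) * a m ≤ Real.exp (f m x) := by
    rw [← Real.exp_log (ha m), ← Real.exp_add, Real.exp_le_exp]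
    linarith [(abs_le.1 (h m)).1]
  have h2 : ∑ j, Real.exp (f j x) ≤ Real.exp (ε - c) * ∑ j, a j := by
    rw [Finset.mul_sum]
    refine Finset.sum_le_sum fun j _ => ?_
    rw [← Real.exp_log (ha j), ← Real.exp_add, Real.exp_le_exp]
    linarith [(abs_le.1 (h j)).2]
  have h3 : Real.exp (-(2 * ε)) = Real.exp (-ε - c) / Real.exp (ε - c) := by
    rw [← Real.exp_sub]; congr 1; ring
  rw [h3, div_mul_div_comm]
  exact div_le_div₀ (Real.exp_pos _).le h1 hT h2

/-! ### Cross-entropy risk and conditional entropy -/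

theorem condProb_mem_stdSimplex {𝒳 : Type*} [MeasurableSpace 𝒳] {M : ℕ} (κ : Kernel 𝒳 (Fin M))
    [IsMarkovKernel κ] (x : 𝒳) : (fun m => condProb κ m x) ∈ stdSimplex ℝ (Fin M) := by
  refine ⟨fun m => measureReal_nonneg, ?_⟩
  simp only [condProb]
  rw [sum_measureReal_singleton]
  simp

theorem measurable_condProb {𝒳 : Type*} [MeasurableSpace 𝒳] {M : ℕ} (κ : Kernel 𝒳 (Fin M))
    (m : Fin M) : Measurable (condProb κ m) :=
  (κ.measurable_coe (measurableSet_singleton m)).ennreal_toReal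

theorem measurable_ceLoss {M : ℕ} (y : Fin M) : Measurable (ceLoss y) := by
  unfold ceLoss
  refine Measurable.ite (measurableSet_le (by fun_prop) (by fun_prop)) (by fun_prop) ?_
  fun_prop

theorem ceRisk_eq_lintegral {𝒳 : Type*} [MeasurableSpace 𝒳] {M : ℕ} (P : Measure (𝒳 × Fin M))
    [IsFiniteMeasure P] (κ : Kernel 𝒳 (Fin M)) [IsMarkovKernel κ] [P.IsCondKernel κ]
    {q : 𝒳 → Fin M → ℝ} (hq : Measurable q) :
    ceRisk P q = ∫⁻ x, ∑ m, ENNReal.ofReal (condProb κ m x) * ceLoss m (q x) ∂P.fst := by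
  have hm : Measurable fun z : 𝒳 × Fin M => ceLoss z.2 (q z.1) :=
    measurable_from_prod_countable_left fun y => (measurable_ceLoss y).comp hq
  unfold ceRisk
  conv_lhs => rw [← P.disintegrate κ]
  rw [Measure.lintegral_compProd hm]
  refine lintegral_congr fun x => ?_
  rw [lintegral_fintype]
  refine Finset.sum_congr rfl fun m _ => ?_
  rw [mul_comm, condProb, ofReal_measureReal]

theorem sum_ofReal_mul_ceLoss {M : ℕ} {p q : Fin M → ℝ} (hp : ∀ m, 0 ≤ p m)
    (hq1 : ∀ m, q m ≤ 1) (hpq : ∀ m, p m ≠ 0 → 0 < q m) :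
    ∑ m, ENNReal.ofReal (p m) * ceLoss m q = ENNReal.ofReal (∑ m, p m * -Real.log (q m)) := by
  have h : ∀ m, 0 ≤ p m * -Real.log (q m) := fun m => by
    by_cases h0 : p m = 0
    · simp [h0]
    · exact mul_nonneg (hp m) (neg_nonneg.2 (Real.log_nonpos (hpq m h0).le (hq1 m)))
  rw [ENNReal.ofReal_sum_of_nonneg fun m _ => h m]
  refine Finset.sum_congr rfl fun m _ => ?_
  by_cases h0 : p m = 0
  · simp [h0]
  · rw [ceLoss, if_neg (not_le.2 (hpq m h0)), ENNReal.ofReal_mul (hp m)]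

/-- Gibbs' inequality. -/
theorem sum_negMulLog_le {M : ℕ} {p q : Fin M → ℝ} (hp : p ∈ stdSimplex ℝ (Fin M))
    (hq : q ∈ stdSimplex ℝ (Fin M)) (hpq : ∀ m, p m ≠ 0 → 0 < q m) :
    ∑ m, Real.negMulLog (p m) ≤ ∑ m, p m * -Real.log (q m) := by
  have h : ∑ m, (Real.negMulLog (p m) - p m * -Real.log (q m)) ≤ ∑ m, (q m - p m) := by
    refine Finset.sum_le_sum fun m _ => ?_
    by_cases h0 : p m = 0
    · simp [h0, hq.1 m]
    · have hpm : 0 < p m := lt_of_le_of_ne (hp.1 m) (Ne.symm h0)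
      have hqm := hpq m h0
      -- `log u ≤ u - 1` at `u = q m / p m`; the right-hand sides sum to at most zero excess.
      have h1 := Real.log_le_sub_one_of_pos (div_pos hqm hpm)
      rw [Real.log_div hqm.ne' h0] at h1
      have h2 := mul_le_mul_of_nonneg_left h1 hpm.le
      have h3 : p m * (q m / p m - 1) = q m - p m := by field_simp
      rw [Real.negMulLog]
      linarith
  rw [Finset.sum_sub_distrib, Finset.sum_sub_distrib, hp.2, hq.2] at h
  linarith

theorem ofReal_sum_negMulLog_le {M : ℕ} {p q : Fin M → ℝ} (hp : p ∈ stdSimplex ℝ (Fin M))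
    (hq : q ∈ stdSimplex ℝ (Fin M)) :
    ENNReal.ofReal (∑ m, Real.negMulLog (p m)) ≤ ∑ m, ENNReal.ofReal (p m) * ceLoss m q := by
  by_cases hpq : ∀ m, p m ≠ 0 → 0 < q m
  · rw [sum_ofReal_mul_ceLoss hp.1 (fun m => (mem_Icc_of_mem_stdSimplex hq m).2) hpq]
    exact ENNReal.ofReal_le_ofReal (sum_negMulLog_le hp hq hpq)
  · push Not at hpq
    obtain ⟨m, hpm, hqm⟩ := hpq
    have hpos : 0 < p m := lt_of_le_of_ne (hp.1 m) (Ne.symm hpm)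
    have h : ENNReal.ofReal (p m) * ceLoss m q = ⊤ := by
      rw [ceLoss, if_pos hqm, ENNReal.mul_top (ENNReal.ofReal_pos.2 hpos).ne']
    exact le_top.trans (h ▸ Finset.single_le_sum
      (f := fun m => ENNReal.ofReal (p m) * ceLoss m q) (fun _ _ => zero_le) (Finset.mem_univ m))

/-- The conditional entropy bounds the minimal risk from below. -/
theorem lintegral_entropy_le_minCERisk {𝒳 : Type*} [MeasurableSpace 𝒳] {M : ℕ}
    (P : Measure (𝒳 × Fin M)) [IsFiniteMeasure P] (κ : Kernel 𝒳 (Fin M)) [IsMarkovKernel κ]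
    [P.IsCondKernel κ] :
    ∫⁻ x, ENNReal.ofReal (∑ m, Real.negMulLog (condProb κ m x)) ∂P.fst ≤ minCERisk P := by
  refine le_iInf₂ fun q hq => ?_
  rw [ceRisk_eq_lintegral P κ hq.1]
  exact lintegral_mono fun x => ofReal_sum_negMulLog_le (condProb_mem_stdSimplex κ x) (hq.2 x)

/-- Flooring a probability vector at `s` and renormalizing costs at most the added mass. -/
theorem sum_floor_bounds {M : ℕ} {p : Fin M → ℝ} (hp : p ∈ stdSimplex ℝ (Fin M)) {s : ℝ}
    (hs : 0 ≤ s) :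
    1 ≤ ∑ m, max (p m) s ∧ ∑ m, max (p m) s ≤ 1 + M * s ∧
      ∑ m, max (p m) s - 1 ≤ ∑ m, if p m ≤ s then s else 0 := by
  refine ⟨?_, ?_, ?_⟩
  · rw [← hp.2]; exact Finset.sum_le_sum fun m _ => le_max_left _ _
  · have : ∑ m, max (p m) s ≤ ∑ m, (p m + s) :=
      Finset.sum_le_sum fun m _ => max_le (by linarith) (by linarith [hp.1 m])
    rw [Finset.sum_add_distrib, hp.2] at this
    simpa using this
  · rw [← hp.2, ← Finset.sum_sub_distrib]
    refine Finset.sum_le_sum fun m _ => ?_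
    split_ifs with h
    · rw [max_eq_right h]; linarith [hp.1 m]
    · rw [max_eq_left (not_le.1 h).le]; simp

/-- If `r` is, up to a factor `exp (-δ)`, the floored and renormalized vector `p`, then its
cross-entropy exceeds the entropy of `p` by at most the added mass and `δ`. -/
theorem sum_ofReal_mul_ceLoss_le_of_near {M : ℕ} {p r : Fin M → ℝ}
    (hp : p ∈ stdSimplex ℝ (Fin M)) (hr : r ∈ stdSimplex ℝ (Fin M)) {s δ : ℝ} (hs : 0 < s)
    (h : ∀ m, Real.exp (-δ) * (max (p m) s / ∑ j, max (p j) s) ≤ r m) :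
    ∑ m, ENNReal.ofReal (p m) * ceLoss m r ≤
      ENNReal.ofReal (∑ m, Real.negMulLog (p m)) +
        (∑ m, if p m ≤ s then ENNReal.ofReal s else 0) + ENNReal.ofReal δ := by
  obtain ⟨hZ1, -, hZ⟩ := sum_floor_bounds hp hs.le
  set Z := ∑ m, max (p m) s
  have hZ0 : 0 < Z := by linarith
  have hm0 : ∀ m, 0 < max (p m) s := fun m => lt_max_of_lt_right hs
  have hr0 : ∀ m, 0 < r m := fun m =>
    (mul_pos (Real.exp_pos _) (div_pos (hm0 m) hZ0)).trans_le (h m)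
  rw [sum_ofReal_mul_ceLoss hp.1 (fun m => (mem_Icc_of_mem_stdSimplex hr m).2) fun m _ => hr0 m]
  -- Flooring only raises `log p m`; renormalizing costs `log Z ≤ Z - 1`, the added mass.
  have h1 : ∀ m, p m * -Real.log (r m) ≤ Real.negMulLog (p m) + p m * ((Z - 1) + δ) := by
    intro m
    rcases (hp.1 m).eq_or_lt with h0 | h0
    · simp [← h0]
    · have h2 := Real.log_le_log (mul_pos (Real.exp_pos _) (div_pos (hm0 m) hZ0)) (h m)
      rw [Real.log_mul (Real.exp_pos _).ne' (div_pos (hm0 m) hZ0).ne', Real.log_exp,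
        Real.log_div (hm0 m).ne' hZ0.ne'] at h2
      have h3 := Real.log_le_sub_one_of_pos hZ0
      have h4 := Real.log_le_log h0 (le_max_left (p m) s)
      have h5 : -Real.log (r m) ≤ -Real.log (p m) + ((Z - 1) + δ) := by linarith
      have h6 := mul_le_mul_of_nonneg_left h5 h0.le
      rw [Real.negMulLog]
      linarith
  have h2 : ∑ m, p m * -Real.log (r m) ≤
      ∑ m, Real.negMulLog (p m) + (∑ m, if p m ≤ s then s else 0) + δ := by
    refine (Finset.sum_le_sum fun m _ => h1 m).trans ?_
    rw [Finset.sum_add_distrib, ← Finset.sum_mul, hp.2]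
    linarith
  refine (ENNReal.ofReal_le_ofReal h2).trans (ENNReal.ofReal_add_le.trans ?_)
  gcongr
  refine ENNReal.ofReal_add_le.trans ?_
  gcongr
  rw [ENNReal.ofReal_sum_of_nonneg fun m _ => by split_ifs <;> linarith]
  refine Finset.sum_le_sum fun m _ => ?_
  split_ifs <;> simp

theorem sum_ofReal_mul_ceLoss_le_of_le {M : ℕ} {p r : Fin M → ℝ}
    (hp : p ∈ stdSimplex ℝ (Fin M)) {t : ℝ} (ht : 0 < t) (hr : ∀ m, t ≤ r m) :
    ∑ m, ENNReal.ofReal (p m) * ceLoss m r ≤ ENNReal.ofReal (-Real.log t) := by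
  calc ∑ m, ENNReal.ofReal (p m) * ceLoss m r
      ≤ ∑ m, ENNReal.ofReal (p m) * ENNReal.ofReal (-Real.log t) := by
        refine Finset.sum_le_sum fun m _ => ?_
        rw [ceLoss, if_neg (not_le.2 (ht.trans_le (hr m)))]
        gcongr
        exact hr m
    _ = _ := by
        rw [← Finset.sum_mul, ← ENNReal.ofReal_sum_of_nonneg fun m _ => hp.1 m, hp.2]
        simp

theorem measurable_truncateBelow {M : ℕ} (t : ℝ) : Measurable (truncateBelow (M := M) t) := by
  refine measurable_pi_lambda _ fun m => ?_
  unfold truncateBelow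
  simp only [Finset.sum_filter]
  refine Measurable.ite (measurableSet_lt (by fun_prop) (by fun_prop)) (by fun_prop) ?_
  refine (by fun_prop : Measurable fun q : Fin M → ℝ => q m).sub (Measurable.mul (by fun_prop) ?_)
  refine Measurable.div ?_ ?_
  · exact Finset.measurable_sum _ fun j _ => Measurable.ite
      (measurableSet_lt (by fun_prop) (by fun_prop)) (by fun_prop) (by fun_prop)
  · exact Finset.measurable_sum _ fun j _ => Measurable.ite
      (measurableSet_le (by fun_prop) (by fun_prop)) (by fun_prop) (by fun_prop)
-- Approximation on compact sets
/-- A finite measure on a subset of `ℝ^d` is concentrated on a compact set. -/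
theorem exists_isCompact_measure_preimage_compl_le {d : ℕ} {𝒳 : Set (EuclideanSpace ℝ (Fin d))}
    (μ : Measure 𝒳) [IsFiniteMeasure μ] {ε : ℝ≥0∞} (hε : 0 < ε) :
    ∃ K : Set (EuclideanSpace ℝ (Fin d)), IsCompact K ∧ μ (Subtype.val ⁻¹' Kᶜ) ≤ ε := by
  -- Tightness is used for the pushforward to `ℝ^d`. The compact set may leave `𝒳`, which is why the
  -- class probabilities are extended to the whole space.
  obtain ⟨K, hK, h⟩ := isTightMeasureSet_iff_exists_isCompact_measure_compl_le.1
    (isTightMeasureSet_singleton (μ := μ.map Subtype.val)) ε hε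
  refine ⟨K, hK, ?_⟩
  rw [← Measure.map_apply measurable_subtype_coe hK.measurableSet.compl]
  exact h _ rfl

/-- Scores in the Gaussian RKHS whose softmax is, on a compact set, within a factor `exp (-δ)` of
given floored and renormalized class probabilities. -/
theorem exists_mem_scoreClass_near {M d : ℕ} [NeZero M] {γ s δ : ℝ} (hγ : 0 < γ) (hs : 0 < s)
    (hδ : 0 < δ) (p : Fin M → C(EuclideanSpace ℝ (Fin d), ℝ))
    {K : Set (EuclideanSpace ℝ (Fin d))} (hK : IsCompact K) :
    ∃ f ∈ scoreClass M d γ, (∀ m, Continuous (f m)) ∧ ∀ x ∈ K, ∀ m,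
      Real.exp (-δ) * (max (p m x) s / ∑ j, max (p j x) s) ≤ softmaxModel f x m := by
  have hpos : ∀ m x, 0 < max (p m x) s := fun m x => lt_max_of_lt_right hs
  -- The log-probability of the last class is subtracted from all scores, so that the last score is
  -- exactly zero.
  let l : Fin M := ⟨M - 1, Nat.sub_lt (NeZero.pos M) one_pos⟩
  let g : Fin M → C(EuclideanSpace ℝ (Fin d), ℝ) := fun m =>
    ⟨fun x => Real.log (max (p m x) s) - Real.log (max (p l x) s), by
      refine Continuous.sub ?_ ?_ <;>
      exact Continuous.log (by fun_prop) fun x => (hpos _ x).ne'⟩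
  choose h hc hh using fun m => exists_gaussianRKHS_near hγ (g m) hK (half_pos hδ)
  refine ⟨fun m => if (m : ℕ) + 1 = M then 0 else h m, fun m hm => by simp [hm], fun m => ?_,
    fun x hx m => ?_⟩
  · dsimp only
    split_ifs
    · rw [RKHS.coe_zero]; exact continuous_zero
    · exact hc m
  · have := mul_softmaxModel_ge (ε := δ / 2) (c := Real.log (max (p l x) s))
      (fun m => if (m : ℕ) + 1 = M then (0 : GaussianRKHS d γ) else h m) x (fun m => hpos m x)
      (fun m => ?_) m
    · rwa [mul_div_cancel₀ _ (two_ne_zero' ℝ)] at this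
    · by_cases hm : (m : ℕ) + 1 = M
      · have hml : m = l := Fin.ext (by simp only [l]; omega)
        rw [if_pos hm, hml]
        simpa using (half_pos hδ).le
      · rw [if_neg hm]
        exact hh m x hx

/-- For every `ρ > 0` some truncated softmax model has excess risk at most `ρ` plus the mass added
by flooring the class probabilities at `2t`. -/
theorem exists_mem_scoreClass_ceRisk_le {M d : ℕ} [NeZero M]
    {𝒳 : Set (EuclideanSpace ℝ (Fin d))} (P : Measure (𝒳 × Fin M)) (κ : Kernel 𝒳 (Fin M))
    [IsProbabilityMeasure P] [IsMarkovKernel κ] [P.IsCondKernel κ]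
    (hκ : ∀ m, UniformContinuous (condProb κ m)) {γ t ρ : ℝ} (hγ : 0 < γ) (ht : 0 < t)
    (hMt : 2 * M * t < 1) (hρ : 0 < ρ) :
    ∃ f ∈ scoreClass M d γ,
      ceRisk P (fun x => truncateBelow t (softmaxModel f x)) ≤
        minCERisk P + ∑ m, ENNReal.ofReal (2 * t) * P.fst {x | condProb κ m x ≤ 2 * t} +
          ENNReal.ofReal ρ := by
  choose p hp using fun m => (hκ m).exists_continuousMap_extension
  -- The first bound spends half of `ρ`; the second keeps the softmax above `t` on `K`.
  set δ := min (ρ / 2) ((1 - 2 * M * t) / 2) with hδdef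
  have hδ : 0 < δ := lt_min (by linarith) (by linarith)
  set B := ENNReal.ofReal (-Real.log t)
  -- The loss off `K` is at most `B`, so this mass costs the other half of `ρ`.
  obtain ⟨K, hK, hKP⟩ := exists_isCompact_measure_preimage_compl_le P.fst
    (ε := ENNReal.ofReal (ρ / 2) / B)
    (ENNReal.div_pos (ENNReal.ofReal_pos.2 (by linarith)).ne' ENNReal.ofReal_ne_top)
  obtain ⟨f, hf, hfc, hfK⟩ := exists_mem_scoreClass_near hγ (s := 2 * t) (by linarith) hδ p hK
  refine ⟨f, hf, ?_⟩
  have hsm : Measurable fun x : EuclideanSpace ℝ (Fin d) => softmaxModel f x := by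
    refine measurable_pi_lambda _ fun m => ?_
    have := fun m => (hfc m).measurable
    unfold softmaxModel
    fun_prop
  have hmeas : Measurable fun x : 𝒳 => truncateBelow t (softmaxModel f x) :=
    (measurable_truncateBelow t).comp (hsm.comp measurable_subtype_coe)
  have hMt' : M * t ≤ 1 := by nlinarith [(Nat.cast_nonneg M : (0 : ℝ) ≤ M)]
  have hset : ∀ m, MeasurableSet {x | condProb κ m x ≤ 2 * t} := fun m =>
    measurableSet_le (measurable_condProb κ m) measurable_const
  have hKset : MeasurableSet (Subtype.val ⁻¹' Kᶜ : Set 𝒳) :=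
    measurable_subtype_coe hK.measurableSet.compl
  have hpt : ∀ x : 𝒳, ∑ m, ENNReal.ofReal (condProb κ m x) *
        ceLoss m (truncateBelow t (softmaxModel f x)) ≤
      ENNReal.ofReal (∑ m, Real.negMulLog (condProb κ m x)) +
        (∑ m, {x | condProb κ m x ≤ 2 * t}.indicator (fun _ => ENNReal.ofReal (2 * t)) x) +
        ENNReal.ofReal δ + (Subtype.val ⁻¹' Kᶜ : Set 𝒳).indicator (fun _ => B) x := by
    intro x
    have hs := condProb_mem_stdSimplex κ x
    by_cases hx : (x : EuclideanSpace ℝ (Fin d)) ∈ K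
    · have h1 : ∀ m, Real.exp (-δ) *
          (max (condProb κ m x) (2 * t) / ∑ j, max (condProb κ j x) (2 * t)) ≤
          softmaxModel f x m := fun m => by
        simpa only [hp] using hfK x hx m
      have h2 : ∀ m, t ≤ softmaxModel f x m := fun m => by
        refine le_trans ?_ (h1 m)
        obtain ⟨hZ1, hZ2, -⟩ := sum_floor_bounds hs (s := 2 * t) (by linarith)
        have h3 := Real.add_one_le_exp (-δ)
        have h4 : δ ≤ (1 - 2 * M * t) / 2 := min_le_right _ _
        rw [← mul_div_assoc, le_div_iff₀ (by linarith)]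
        calc t * ∑ j, max (condProb κ j x) (2 * t) ≤ t * (1 + M * (2 * t)) := by gcongr
          -- `exp(-δ) ≥ 1 - δ ≥ (1 + 2Mt)/2`; the floor `2t` instead of `t` leaves this room.
          _ ≤ Real.exp (-δ) * (2 * t) := by nlinarith
          _ ≤ _ := by gcongr; exact le_max_right _ _
      rw [truncateBelow_eq_self h2]
      refine le_add_right ?_
      exact sum_ofReal_mul_ceLoss_le_of_near hs (softmaxModel_mem_stdSimplex f x)
        (by linarith) h1
    · refine le_add_left ?_
      rw [Set.indicator_of_mem (show x ∈ Subtype.val ⁻¹' Kᶜ from hx)]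
      exact sum_ofReal_mul_ceLoss_le_of_le hs ht
        (le_truncateBelow (softmaxModel_mem_stdSimplex f x) hMt')
  have hM1 : ∀ m, Measurable
      ({x | condProb κ m x ≤ 2 * t}.indicator fun _ => ENNReal.ofReal (2 * t)) :=
    fun m => measurable_const.indicator (hset m)
  have hM2 := Finset.measurable_fun_sum Finset.univ fun m _ => hM1 m
  rw [ceRisk_eq_lintegral P κ hmeas]
  refine (lintegral_mono hpt).trans ?_
  rw [lintegral_add_right _ (measurable_const.indicator hKset),
    lintegral_add_right _ measurable_const, lintegral_add_right _ hM2,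
    lintegral_finsetSum _ fun m _ => hM1 m, lintegral_indicator_const hKset, lintegral_const,
    measure_univ, mul_one, add_assoc]
  simp only [lintegral_indicator_const (hset _)]
  gcongr
  · exact lintegral_entropy_le_minCERisk P κ
  · calc ENNReal.ofReal δ + B * P.fst (Subtype.val ⁻¹' Kᶜ)
        ≤ ENNReal.ofReal (ρ / 2) + ENNReal.ofReal (ρ / 2) := by
          gcongr
          · exact min_le_left _ _
          · exact (mul_le_mul_right hKP B).trans ENNReal.mul_div_le
      _ = ENNReal.ofReal ρ := by
          rw [← ENNReal.ofReal_add (by linarith) (by linarith), add_halves]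

/-! ### The rate -/

theorem mainTheorem7 (d M : ℕ) (α β cα cβ : ℝ) (hM : 1 ≤ M)
    (hα0 : 0 < α) (hα1 : α ≤ 1) (hβ : 0 ≤ β) (hcα : 0 < cα) (hcβ : 0 < cβ) :
    ∃ C : ℝ, 0 < C ∧
      ∀ (𝒳 : Set (EuclideanSpace ℝ (Fin d))) (P : Measure (𝒳 × Fin M)) (κ : Kernel 𝒳 (Fin M)),
        IsProbabilityMeasure P → IsMarkovKernel κ → P.IsCondKernel κ →
        HolderSmooth κ α cα → SmallValueBound P κ β cβ →
        ∀ γ t : ℝ, 0 < γ → γ < (2 * (M : ℝ)) ^ (-1 / α) → 0 < t → t ≤ γ ^ α →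
          ∃ f₀ ∈ scoreClass M d γ,
            ceRisk P (fun x => truncateBelow t (softmaxModel f₀ x)) ≤
              minCERisk P + ENNReal.ofReal (C * γ ^ (α * (1 + min β 1))) := by
  -- The first term pays for flooring the `M` classes at `2t`, the `1` for the approximation error
  -- `ρ = R`.
  refine ⟨M * cβ * 2 ^ (1 + β) + 1, by positivity, ?_⟩
  intro 𝒳 P κ hP hκ hPκ hH hS γ t hγ hγM ht htγ
  have : NeZero M := ⟨by omega⟩
  have hM1 : (1 : ℝ) ≤ M := by exact_mod_cast hM
  have hγα : γ ^ α < (2 * (M : ℝ))⁻¹ := by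
    have h := Real.rpow_lt_rpow hγ.le hγM hα0
    rwa [← Real.rpow_mul (by positivity), div_mul_cancel₀ _ hα0.ne', Real.rpow_neg_one] at h
  have hMt : 2 * M * t < 1 := by
    have h := htγ.trans_lt hγα
    rw [← one_div, lt_div_iff₀ (by positivity)] at h
    linarith
  have h2t : 2 * t ≤ 1 := by nlinarith
  have hγα1 : γ ^ α ≤ 1 := hγα.le.trans (inv_le_one_of_one_le₀ (by linarith))
  set R := γ ^ (α * (1 + min β 1)) with hR
  have hR0 : 0 < R := Real.rpow_pos_of_pos hγ _
  have htR : (2 * t) * (cβ * (2 * t) ^ β) ≤ cβ * 2 ^ (1 + β) * R := by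
    have h1 : (2 * t) * (cβ * (2 * t) ^ β) = cβ * 2 ^ (1 + β) * t ^ (1 + β) := by
      rw [mul_assoc cβ, ← Real.mul_rpow zero_le_two ht.le, Real.rpow_add (by positivity),
        Real.rpow_one]
      ring
    rw [h1]
    gcongr
    calc t ^ (1 + β) ≤ (γ ^ α) ^ (1 + β) := Real.rpow_le_rpow ht.le htγ (by linarith)
      -- Lowering the exponent weakens the bound because `γ ^ α ≤ 1`.
      _ ≤ (γ ^ α) ^ (1 + min β 1) :=
        Real.rpow_le_rpow_of_exponent_ge (Real.rpow_pos_of_pos hγ _) hγα1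
          (by linarith [min_le_left β 1])
      _ = R := by rw [hR, Real.rpow_mul hγ.le]
  obtain ⟨f, hf, h⟩ := exists_mem_scoreClass_ceRisk_le P κ
    (fun m => hH.uniformContinuous hα0 hcα m) hγ ht hMt hR0
  refine ⟨f, hf, h.trans ?_⟩
  rw [add_assoc]
  gcongr
  calc ∑ m, ENNReal.ofReal (2 * t) * P.fst {x | condProb κ m x ≤ 2 * t} + ENNReal.ofReal R
      ≤ ∑ _m : Fin M, ENNReal.ofReal (cβ * 2 ^ (1 + β) * R) + ENNReal.ofReal R := by
        gcongr with m
        refine (mul_le_mul_right (hS m (2 * t) (by positivity) h2t) _).trans ?_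
        rw [← ENNReal.ofReal_mul (by positivity)]
        exact ENNReal.ofReal_le_ofReal htR
    _ = ENNReal.ofReal ((M * cβ * 2 ^ (1 + β) + 1) * R) := by
        rw [← ENNReal.ofReal_sum_of_nonneg fun _ _ => by positivity,
          ← ENNReal.ofReal_add (by positivity) hR0.le]
        simp only [Finset.sum_const, Finset.card_univ, Fintype.card_fin, nsmul_eq_mul]
        congr 1
        ring
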